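/- Work in the many-sorted language of the situation calculus with sorts situation, action, object and real (time points and real-valued quantities; this sort and the symbols on it always have the standard interpretation over $\mathbb{R}$). Its symbols are the constant $S_0$, the function $do(a,s)$, the predicates $Poss(a,s)$ and $s \sqsubset s'$, the functions $time(a)$ and $start(s)$, action functions $A(\bar x,t)$ (all with a time argument), situation-independent predicates and functions, relational fluents $F(\bar x,s)$, atemporal functional fluents $f(\bar x,s)$, and finitely many temporal functional fluents $f(\bar x,t,s)$, each accompanied by an atemporal functional fluent $f_{init}(\bar x,s)$. A first-order formula is uniform in $s$ if its only situation term is $s$, it does not mention $Poss$ or $\sqsubset$, it has no equality between situations and no quantifier over situations. Free variables of axioms are universally quantified. A temporal basic action theory is $\mathcal D=\Sigma\cup\mathcal D_{ss}\cup\mathcal D_{ap}\cup\mathcal D_{una}\cup\mathcal D_{S_0}\cup\mathcal D_{se}$, where - $\Sigma$ consists of $do(a,s)=do(a',s')\to a=a'\wedge s=s'$, the second-order induction axiom for situations (from $S_0$ along $do$), $\neg(s\sqsubset S_0)$, $s\sqsubset do(a,s')\leftrightarrow (s\sqsubset s'\vee s=s')$, and $start(do(a,s))=time(a)$; - $\mathcal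 D_{una}$ says that distinct action functions have disjoint ranges and that each action function is injective; - $\mathcal D_{S_0}$ is a set of sentences uniform in $S_0$ together with $time(A(\bar x,t))=t$ for every action function $A$; - $\mathcal D_{ap}$ contains one axiom $Poss(A(\bar x,t),s)\leftrightarrow\Pi_A(\bar x,t,s)$ for each action function $A$; - $\mathcal D_{ss}$ contains one axiom $F(\bar x,do(a,s))\leftrightarrow\Phi_F(\bar x,a,s)$ for each relational fluent, one axiom $f(\bar x,do(a,s))=y\leftrightarrow\phi_f(\bar x,y,a,s)$ for each atemporal functional fluent, and one axiom $f_{init}(\bar x,do(a,s))=y\leftrightarrow\Omega_f(\bar x,y,a,s)$ for each temporal fluent $f$; - $\mathcal D_{se}$ contains one state evolution axiom $f(\bar x,t,s)=y\leftrightarrow\psi_f(\bar x,t,y,s)$ for each temporal fluent $f$; all right-hand sides are uniform in $s$ with no free variables other than those shown, and $\mathcal D_{una}\cup\mathcal D_{S_0}$ entails, for all $\bar x,a,s$ (respectively $\bar x,t,s$), that there is exactly one $y$ with $\phi_f(\bar x,y,a,s)$, exactly one $y$ with $\Omega_f(\bar x,y,a,s)$, exactly one $y$ with $\psi_f(\bar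 x,t,y,s)$, and that $\exists y\,(f_{init}(\bar x,s)=y\wedge\psi_f(\bar x,start(s),y,s))$. The theory is stratified if there are no temporal fluents $f_1,\dots,f_n$ ($n\ge 1$) with $f_1\succ f_2\succ\dots\succ f_n\succ f_1$, where $f\succ f'$ means that $f'$ occurs in $\psi_f$. Theorem. Let $\mathcal D$ be a stratified temporal basic action theory such that, for every temporal fluent $f$ that occurs in a sentence of $\mathcal D_{S_0}$ (if there is any), $\mathcal D_{una}\cup\mathcal D_{S_0}$ entails the state evolution axiom of $f$ at the initial situation, $\forall\bar x\,\forall t\,\forall y\,(f(\bar x,t,S_0)=y\leftrightarrow\psi_f(\bar x,t,y,S_0))$. Then $\mathcal D$ is satisfiable if and only if $\mathcal D_{una}\cup\mathcal D_{S_0}$ is satisfiable. -/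

import Mathlib

namespace HybridSC

/-- The sorts other than the sort of situations. Time points and real-valued physical
quantities share the sort `real`, which is always interpreted by `ℝ`. -/
inductive Srt where
  | object
  | action
  | real

/-- The interpretation of the sorts, given the domains of objects and of actions. -/
@[reducible]
def Carrier (O A : Type) : Srt → Type
  | .object => O
  | .action => A
  | .real => ℝ

/-- Tuples whose `i`-th entry has the `i`-th sort of the list `Γ`. They serve as argument tuples
and as assignments of values to the variables declared by `Γ`. -/
abbrev Tuple (C : Srt → Type) (Γ : List Srt) : Type :=
  ∀ i : Fin Γ.length, C (Γ.get i)

/-- Put a value in front of a tuple. -/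
def Tuple.cons {C : Srt → Type} {σ : Srt} {Γ : List Srt} (x : C σ) (e : Tuple C Γ) :
    Tuple C (σ :: Γ) :=
  Fin.cons (α := fun i => C ((σ :: Γ).get i)) x e

/-- The domain-dependent alphabet. The symbols `S₀`, `do`, `Poss`, `⊏`, `time`, `start` and the
symbols with a standard interpretation over the reals are common to all alphabets.
Situation arguments, the time argument of an action function and the time argument of a temporal
fluent are not listed in the argument sorts. -/
structure Signature where
  /-- situation-independent predicate symbols -/
  StaticRel : Type
  staticRelDom : StaticRel → List Srt
  /-- situation-independent function symbols -/
  StaticFun : Type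
  staticFunDom : StaticFun → List Srt
  staticFunCod : StaticFun → Srt
  /-- all function symbols with values of sort action are action functions -/
  staticFunCod_ne : ∀ g, staticFunCod g ≠ Srt.action
  /-- action functions `A(x̄, t)` -/
  ActFun : Type
  actDom : ActFun → List Srt
  /-- relational fluents `F(x̄, s)` -/
  RelFluent : Type
  relDom : RelFluent → List Srt
  /-- atemporal functional fluents `f(x̄, s)`, other than the fluents `f_init` -/
  FunFluent : Type
  funDom : FunFluent → List Srt
  funCod : FunFluent → Srt
  /-- temporal functional fluents `f(x̄, t, s)`; each of them brings along an atemporal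
  functional fluent `f_init(x̄, s)` -/
  TempFluent : Type
  tempDom : TempFluent → List Srt
  tempCod : TempFluent → Srt

/-- Terms of a sort other than situation, uniform in a situation `s`, with variables declared
by `Γ`. The only term of sort situation that occurs in a uniform term is `s` itself, so the
situation argument of a fluent and of `start` is not written. -/
inductive Term (L : Signature) (Γ : List Srt) : Srt → Type
  | var (i : Fin Γ.length) : Term L Γ (Γ.get i)
  /-- a function on the reals, with its standard interpretation -/
  | realFun {n : ℕ} (h : (Fin n → ℝ) → ℝ) (ts : Fin n → Term L Γ .real) : Term L Γ .real
  | staticFun (g : L.StaticFun)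
      (ts : ∀ i : Fin (L.staticFunDom g).length, Term L Γ ((L.staticFunDom g).get i)) :
      Term L Γ (L.staticFunCod g)
  | actFun (A : L.ActFun)
      (ts : ∀ i : Fin (L.actDom A).length, Term L Γ ((L.actDom A).get i))
      (t : Term L Γ .real) : Term L Γ .action
  | time (a : Term L Γ .action) : Term L Γ .real
  | start : Term L Γ .real
  | funFluent (f : L.FunFluent)
      (ts : ∀ i : Fin (L.funDom f).length, Term L Γ ((L.funDom f).get i)) :
      Term L Γ (L.funCod f)
  | initFluent (f : L.TempFluent)
      (ts : ∀ i : Fin (L.tempDom f).length, Term L Γ ((L.tempDom f).get i)) :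
      Term L Γ (L.tempCod f)
  | tempFluent (f : L.TempFluent)
      (ts : ∀ i : Fin (L.tempDom f).length, Term L Γ ((L.tempDom f).get i))
      (t : Term L Γ .real) : Term L Γ (L.tempCod f)

/-- First-order formulas uniform in a situation `s`, with free variables among those declared
by `Γ` and possibly `s`: they do not mention `Poss` or `⊏`, have no equality between situations,
do not quantify over situations and contain no situation term other than `s`. -/
inductive Formula (L : Signature) : List Srt → Type
  | eq {Γ : List Srt} {σ : Srt} (a b : Term L Γ σ) : Formula L Γ
  /-- a relation on the reals, with its standard interpretation -/
  | realRel {Γ : List Srt} {n : ℕ} (R : Set (Fin n → ℝ)) (ts : Fin n → Term L Γ .real) :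
      Formula L Γ
  | staticRel {Γ : List Srt} (R : L.StaticRel)
      (ts : ∀ i : Fin (L.staticRelDom R).length, Term L Γ ((L.staticRelDom R).get i)) :
      Formula L Γ
  | relFluent {Γ : List Srt} (F : L.RelFluent)
      (ts : ∀ i : Fin (L.relDom F).length, Term L Γ ((L.relDom F).get i)) : Formula L Γ
  | not {Γ : List Srt} (φ : Formula L Γ) : Formula L Γ
  | and {Γ : List Srt} (φ ψ : Formula L Γ) : Formula L Γ
  | ex {Γ : List Srt} (σ : Srt) (φ : Formula L (σ :: Γ)) : Formula L Γ

/-- The temporal functional fluents that occur in a term (`f_init` is not an occurrence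
of `f`). -/
def Term.temps {L : Signature} {Γ : List Srt} : {σ : Srt} → Term L Γ σ → Set L.TempFluent
  | _, .var _ => ∅
  | _, .realFun _ ts => ⋃ i, (ts i).temps
  | _, .staticFun _ ts => ⋃ i, (ts i).temps
  | _, .actFun _ ts t => (⋃ i, (ts i).temps) ∪ t.temps
  | _, .time a => a.temps
  | _, .start => ∅
  | _, .funFluent _ ts => ⋃ i, (ts i).temps
  | _, .initFluent _ ts => ⋃ i, (ts i).temps
  | _, .tempFluent f ts t => {f} ∪ (⋃ i, (ts i).temps) ∪ t.temps

/-- The temporal functional fluents that occur in a formula. -/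
def Formula.temps {L : Signature} : {Γ : List Srt} → Formula L Γ → Set L.TempFluent
  | _, .eq a b => a.temps ∪ b.temps
  | _, .realRel _ ts => ⋃ i, (ts i).temps
  | _, .staticRel _ ts => ⋃ i, (ts i).temps
  | _, .relFluent _ ts => ⋃ i, (ts i).temps
  | _, .not φ => φ.temps
  | _, .and φ ψ => φ.temps ∪ ψ.temps
  | _, .ex _ φ => φ.temps

/-- Structures for the whole language. The sort `real` and the symbols on it have their standard
interpretation; all other sorts and symbols are interpreted arbitrarily. -/
structure Str (L : Signature) where
  Obj : Type
  Act : Type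
  Sit : Type
  obj_nonempty : Nonempty Obj
  act_nonempty : Nonempty Act
  S0 : Sit
  doAct : Act → Sit → Sit
  Poss : Act → Sit → Prop
  /-- the strict order `⊏` on situations -/
  prec : Sit → Sit → Prop
  time : Act → ℝ
  start : Sit → ℝ
  staticRel : ∀ R : L.StaticRel, Tuple (Carrier Obj Act) (L.staticRelDom R) → Prop
  staticFun : ∀ g : L.StaticFun,
    Tuple (Carrier Obj Act) (L.staticFunDom g) → Carrier Obj Act (L.staticFunCod g)
  actFun : ∀ A : L.ActFun, Tuple (Carrier Obj Act) (L.actDom A) → ℝ → Act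
  relFluent : ∀ F : L.RelFluent, Tuple (Carrier Obj Act) (L.relDom F) → Sit → Prop
  funFluent : ∀ f : L.FunFluent,
    Tuple (Carrier Obj Act) (L.funDom f) → Sit → Carrier Obj Act (L.funCod f)
  initFluent : ∀ f : L.TempFluent,
    Tuple (Carrier Obj Act) (L.tempDom f) → Sit → Carrier Obj Act (L.tempCod f)
  tempFluent : ∀ f : L.TempFluent,
    Tuple (Carrier Obj Act) (L.tempDom f) → ℝ → Sit → Carrier Obj Act (L.tempCod f)

/-- The universe of discourse of each sort. -/
abbrev Str.Dom {L : Signature} (M : Str L) : Srt → Type := Carrier M.Obj M.Act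

/-- The value in `M` of a uniform term at the situation `s`. -/
def Term.eval {L : Signature} {Γ : List Srt} (M : Str L) (s : M.Sit) (e : Tuple M.Dom Γ) :
    {σ : Srt} → Term L Γ σ → M.Dom σ
  | _, .var i => e i
  | _, .realFun h ts => h (fun i => (ts i).eval M s e)
  | _, .staticFun g ts => M.staticFun g (fun i => (ts i).eval M s e)
  | _, .actFun A ts t => M.actFun A (fun i => (ts i).eval M s e) (t.eval M s e)
  | _, .time a => M.time (a.eval M s e)
  | _, .start => M.start s
  | _, .funFluent f ts => M.funFluent f (fun i => (ts i).eval M s e) s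
  | _, .initFluent f ts => M.initFluent f (fun i => (ts i).eval M s e) s
  | _, .tempFluent f ts t => M.tempFluent f (fun i => (ts i).eval M s e) (t.eval M s e) s

/-- Truth in `M` of a uniform formula at the situation `s`. -/
def Formula.Holds {L : Signature} (M : Str L) (s : M.Sit) :
    {Γ : List Srt} → Formula L Γ → Tuple M.Dom Γ → Prop
  | _, .eq a b, e => a.eval M s e = b.eval M s e
  | _, .realRel R ts, e => (fun i => (ts i).eval M s e) ∈ R
  | _, .staticRel R ts, e => M.staticRel R (fun i => (ts i).eval M s e)
  | _, .relFluent F ts, e => M.relFluent F (fun i => (ts i).eval M s e) s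
  | _, .not φ, e => ¬ φ.Holds M s e
  | _, .and φ ψ, e => φ.Holds M s e ∧ ψ.Holds M s e
  | _, .ex _ φ, e => ∃ x, φ.Holds M s (Tuple.cons x e)

/-- The foundational axioms `Σ`: unique names for situations, second-order induction on
situations, the two axioms on `⊏`, and the axiom on the starting time of a situation. -/
structure Str.Foundational {L : Signature} (M : Str L) : Prop where
  do_inj : ∀ a₁ a₂ s₁ s₂, M.doAct a₁ s₁ = M.doAct a₂ s₂ → a₁ = a₂ ∧ s₁ = s₂
  induction : ∀ P : M.Sit → Prop, P M.S0 → (∀ a s, P s → P (M.doAct a s)) → ∀ s, P s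
  not_prec_S0 : ∀ s, ¬ M.prec s M.S0
  prec_do : ∀ a s s', M.prec s (M.doAct a s') ↔ M.prec s s' ∨ s = s'
  start_do : ∀ a s, M.start (M.doAct a s) = M.time a

/-- The unique name axioms for actions `D_una`. -/
structure Str.UniqueNames {L : Signature} (M : Str L) : Prop where
  ne : ∀ A B, A ≠ B → ∀ x t x' t', M.actFun A x t ≠ M.actFun B x' t'
  inj : ∀ A x t x' t', M.actFun A x t = M.actFun A x' t' → x = x' ∧ t = t'

/-- The domain-specific axioms of a temporal action theory. Each axiom is given by its
right-hand side, a formula uniform in `s` with the indicated free variables. -/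
structure Theory (L : Signature) where
  /-- sentences uniform in `S₀`; the initial theory `D_S0` consists of them and of the axioms
  `time(A(x̄, t)) = t` -/
  initial : Set (Formula L [])
  /-- `Π_A(t, x̄, s)`, for `Poss(A(x̄, t), s) ↔ Π_A` -/
  precond : ∀ A : L.ActFun, Formula L (.real :: L.actDom A)
  /-- `Φ_F(a, x̄, s)`, for `F(x̄, do(a, s)) ↔ Φ_F` -/
  ssaRel : ∀ F : L.RelFluent, Formula L (.action :: L.relDom F)
  /-- `φ_f(y, a, x̄, s)`, for `f(x̄, do(a, s)) = y ↔ φ_f` -/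
  ssaFun : ∀ f : L.FunFluent, Formula L (L.funCod f :: .action :: L.funDom f)
  /-- `Ω_f(y, a, x̄, s)`, for `f_init(x̄, do(a, s)) = y ↔ Ω_f` -/
  ssaInit : ∀ f : L.TempFluent, Formula L (L.tempCod f :: .action :: L.tempDom f)
  /-- `ψ_f(y, t, x̄, s)`, for `f(x̄, t, s) = y ↔ ψ_f` -/
  sea : ∀ f : L.TempFluent, Formula L (L.tempCod f :: .real :: L.tempDom f)

namespace Theory

variable {L : Signature} (D : Theory L)

/-- `M` satisfies the initial theory `D_S0`. -/
structure ModelsInitial (M : Str L) : Prop where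
  initial : ∀ φ ∈ D.initial, φ.Holds M M.S0 (fun i => i.elim0)
  time_act : ∀ A x t, M.time (M.actFun A x t) = t

/-- `M` satisfies the action precondition axioms `D_ap`. -/
def ModelsPrecond (M : Str L) : Prop :=
  ∀ A x t s, M.Poss (M.actFun A x t) s ↔ (D.precond A).Holds M s (Tuple.cons t x)

/-- `M` satisfies the successor state axioms `D_ss`. -/
structure ModelsSuccessor (M : Str L) : Prop where
  rel : ∀ F x a s, M.relFluent F x (M.doAct a s) ↔
    (D.ssaRel F).Holds M s (Tuple.cons (σ := .action) a x)
  func : ∀ f x a s y, M.funFluent f x (M.doAct a s) = y ↔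
    (D.ssaFun f).Holds M s (Tuple.cons y (Tuple.cons (σ := .action) a x))
  init : ∀ f x a s y, M.initFluent f x (M.doAct a s) = y ↔
    (D.ssaInit f).Holds M s (Tuple.cons y (Tuple.cons (σ := .action) a x))

/-- `M` satisfies the state evolution axiom of `f` at the situation `s`. -/
def EvolvesAt (M : Str L) (f : L.TempFluent) (s : M.Sit) : Prop :=
  ∀ x t y, M.tempFluent f x t s = y ↔
    (D.sea f).Holds M s (Tuple.cons y (Tuple.cons (σ := .real) t x))

/-- `M` satisfies the state evolution axioms `D_se`. -/
def ModelsEvolution (M : Str L) : Prop := ∀ f s, D.EvolvesAt M f s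

/-- `M` is a model of `D = Σ ∪ D_ss ∪ D_ap ∪ D_una ∪ D_S0 ∪ D_se`. -/
structure Models (M : Str L) : Prop where
  foundational : M.Foundational
  successor : D.ModelsSuccessor M
  precond : D.ModelsPrecond M
  uniqueNames : M.UniqueNames
  initial : D.ModelsInitial M
  evolution : D.ModelsEvolution M

/-- `D` is satisfiable. -/
def Satisfiable : Prop := ∃ M : Str L, D.Models M

/-- `D_una ∪ D_S0` is satisfiable. -/
def InitialSatisfiable : Prop := ∃ M : Str L, M.UniqueNames ∧ D.ModelsInitial M

/-- `D_una ∪ D_S0` entails the property `P` of structures. -/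
def InitialEntails (P : Str L → Prop) : Prop :=
  ∀ M : Str L, M.UniqueNames → D.ModelsInitial M → P M

/-- The consistency properties that make `D` a temporal basic action theory. Free variables,
including the situation `s`, are universally quantified. -/
structure IsTemporalBAT : Prop where
  /-- functional fluent consistency, for atemporal functional fluents -/
  func_consistent : ∀ f, D.InitialEntails fun M => ∀ x a s,
    ∃! y, (D.ssaFun f).Holds M s (Tuple.cons y (Tuple.cons (σ := .action) a x))
  /-- functional fluent consistency, for the fluents `f_init` -/
  init_consistent : ∀ f, D.InitialEntails fun M => ∀ x a s,
    ∃! y, (D.ssaInit f).Holds M s (Tuple.cons y (Tuple.cons (σ := .action) a x))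
  /-- each state evolution axiom determines exactly one value -/
  sea_consistent : ∀ f, D.InitialEntails fun M => ∀ x t s,
    (∃ y, (D.sea f).Holds M s (Tuple.cons y (Tuple.cons (σ := .real) t x))) ∧
    ∀ y y', (D.sea f).Holds M s (Tuple.cons y (Tuple.cons (σ := .real) t x)) →
      (D.sea f).Holds M s (Tuple.cons y' (Tuple.cons (σ := .real) t x)) → y = y'
  /-- at the starting time of a situation the value is that of `f_init` -/
  sea_start : ∀ f, D.InitialEntails fun M => ∀ x s,
    ∃ y, M.initFluent f x s = y ∧
      (D.sea f).Holds M s (Tuple.cons y (Tuple.cons (σ := .real) (M.start s) x))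

/-- `f ≻ f'`: the temporal fluent `f'` occurs on the right-hand side of the state evolution axiom
of `f`. -/
def DependsOn (f f' : L.TempFluent) : Prop := f' ∈ (D.sea f).temps

/-- There is no cycle `f₁ ≻ f₂ ≻ … ≻ fₙ ≻ f₁`. -/
def Stratified : Prop := ∀ f, ¬ Relation.TransGen D.DependsOn f f

/-- The initial theory is compatible with the state evolution axioms: whenever a temporal fluent
occurs in an initial axiom, `D_una ∪ D_S0` entails the state evolution axiom of that fluent
at `S₀`. This is void if the initial axioms describe the initial values of the temporal fluents
through the fluents `f_init` only. -/
def InitiallyCompatible : Prop :=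
  ∀ φ ∈ D.initial, ∀ f ∈ φ.temps, D.InitialEntails fun M => D.EvolvesAt M f M.S0

end Theory

end HybridSC

/-! Only the passage from a model `M` of the initial theory to a model of the whole theory needs an
argument. Keep the objects, actions and situation-independent symbols of `M`, discard its
situations, and attach a state to every finite sequence of actions. A uniform formula sees only the
state at its own situation, so states can be chosen by recursion along the tree: the successor state
axioms fix the atemporal fluents, and the state evolution axioms then fix the temporal ones by
recursion along `≻`, well-founded by stratification and finiteness.

Two points carry the proof. The consistency conditions are known only for models of the initial
theory, but that theory constrains no situation except `S₀`; any state can therefore be realised at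
a second situation, where the conditions apply (`InitialEntails.probe`). At `S₀`, the temporal
fluents occurring in initial axioms keep their values, so the initial theory stays true and
compatibility supplies their state evolution axioms; the others are recomputed. -/

namespace HybridSC

variable {L : Signature}

/-! ### States, and truth as a function of the state -/

/-- The interpretation, in one situation, of the symbols that depend on the situation. -/
structure Str.State (M : Str L) where
  start : ℝ
  rel : ∀ F : L.RelFluent, Tuple M.Dom (L.relDom F) → Prop
  func : ∀ f : L.FunFluent, Tuple M.Dom (L.funDom f) → M.Dom (L.funCod f)
  init : ∀ f : L.TempFluent, Tuple M.Dom (L.tempDom f) → M.Dom (L.tempCod f)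
  temp : ∀ f : L.TempFluent, Tuple M.Dom (L.tempDom f) → ℝ → M.Dom (L.tempCod f)

/-- The state of a structure in a situation. -/
def Str.stateAt (M : Str L) (s : M.Sit) : M.State where
  start := M.start s
  rel F x := M.relFluent F x s
  func f x := M.funFluent f x s
  init f x := M.initFluent f x s
  temp f x t := M.tempFluent f x t s

/-- States that agree except perhaps on temporal fluents outside `K`. -/
structure Str.State.AgreeOn {M : Str L} (K : Set L.TempFluent) (σ τ : M.State) : Prop where
  start : σ.start = τ.start
  rel : σ.rel = τ.rel
  func : σ.func = τ.func
  init : σ.init = τ.init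
  temp : ∀ f ∈ K, σ.temp f = τ.temp f

lemma Str.State.AgreeOn.refl {M : Str L} {K : Set L.TempFluent} (σ : M.State) :
    Str.State.AgreeOn K σ σ :=
  ⟨rfl, rfl, rfl, rfl, fun _ _ => rfl⟩

lemma Str.State.AgreeOn.mono {M : Str L} {K K' : Set L.TempFluent} {σ τ : M.State}
    (h : Str.State.AgreeOn K σ τ) (hK : K' ⊆ K) : Str.State.AgreeOn K' σ τ :=
  ⟨h.start, h.rel, h.func, h.init, fun f hf => h.temp f (hK hf)⟩

/-- A domain of situations, with the symbols that are not available in uniform formulas. -/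
structure Str.Frame (M : Str L) where
  Sit : Type
  S0 : Sit
  doAct : M.Act → Sit → Sit
  Poss : M.Act → Sit → Prop
  prec : Sit → Sit → Prop

/-- Replace the situations of a structure, keeping the situation-independent part. -/
@[reducible]
def Str.reframe (M : Str L) (W : M.Frame) (st : W.Sit → M.State) : Str L where
  Obj := M.Obj
  Act := M.Act
  Sit := W.Sit
  obj_nonempty := M.obj_nonempty
  act_nonempty := M.act_nonempty
  S0 := W.S0
  doAct := W.doAct
  Poss := W.Poss
  prec := W.prec
  time := M.time
  start s := (st s).start
  staticRel := M.staticRel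
  staticFun := M.staticFun
  actFun := M.actFun
  relFluent F x s := (st s).rel F x
  funFluent f x s := (st s).func f x
  initFluent f x s := (st s).init f x
  tempFluent f x t s := (st s).temp f x t

/-- The situations of a structure itself. -/
def Str.frame (M : Str L) : M.Frame := ⟨M.Sit, M.S0, M.doAct, M.Poss, M.prec⟩

lemma Term.eval_reframe {M : Str L} {W W' : M.Frame} {st : W.Sit → M.State}
    {st' : W'.Sit → M.State} {s : W.Sit} {s' : W'.Sit} {Γ : List Srt} (e : Tuple M.Dom Γ)
    {σ : Srt} (t : Term L Γ σ) (h : Str.State.AgreeOn t.temps (st s) (st' s')) :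
    t.eval (M.reframe W st) s e = t.eval (M.reframe W' st') s' e := by
  induction t with
  | var i => rfl
  | realFun f ts ih =>
    simp only [Term.temps] at h
    have := fun i => ih i (h.mono (Set.subset_iUnion (fun i => (ts i).temps) i))
    simp only [Term.eval, this]
  | staticFun g ts ih =>
    simp only [Term.temps] at h
    have := fun i => ih i (h.mono (Set.subset_iUnion (fun i => (ts i).temps) i))
    simp only [Term.eval, this]
  | actFun A ts t ih iht =>
    simp only [Term.temps] at h
    have := fun i => ih i (h.mono
      ((Set.subset_iUnion (fun i => (ts i).temps) i).trans Set.subset_union_left))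
    simp only [Term.eval, this, iht (h.mono Set.subset_union_right)]
  | time a ih => simp only [Term.eval, ih h]
  | start => exact h.start
  | funFluent f ts ih =>
    simp only [Term.temps] at h
    have := fun i => ih i (h.mono (Set.subset_iUnion (fun i => (ts i).temps) i))
    simp only [Term.eval, this, h.func]
  | initFluent f ts ih =>
    simp only [Term.temps] at h
    have := fun i => ih i (h.mono (Set.subset_iUnion (fun i => (ts i).temps) i))
    simp only [Term.eval, this, h.init]
  | tempFluent f ts t ih iht =>
    simp only [Term.temps] at h
    have := fun i => ih i (h.mono ((Set.subset_iUnion (fun i => (ts i).temps) i).trans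
      (Set.subset_union_right.trans Set.subset_union_left)))
    simp only [Term.eval, this, iht (h.mono Set.subset_union_right),
      h.temp f (Or.inl (Or.inl rfl))]

/-- Quantifiers range over objects, actions and reals only, so no other situation can influence
truth. -/
lemma Formula.holds_reframe {M : Str L} {W W' : M.Frame} {st : W.Sit → M.State}
    {st' : W'.Sit → M.State} {s : W.Sit} {s' : W'.Sit} {Γ : List Srt} (φ : Formula L Γ)
    (e : Tuple M.Dom Γ) (h : Str.State.AgreeOn φ.temps (st s) (st' s')) :
    φ.Holds (M.reframe W st) s e ↔ φ.Holds (M.reframe W' st') s' e := by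
  induction φ with
  | eq a b =>
    simp only [Formula.Holds, Term.eval_reframe e a (h.mono Set.subset_union_left),
      Term.eval_reframe e b (h.mono Set.subset_union_right)]
  | realRel R ts =>
    simp only [Formula.temps] at h
    have := fun i => Term.eval_reframe e (ts i)
      (h.mono (Set.subset_iUnion (fun i => (ts i).temps) i))
    simp only [Formula.Holds, this]
  | staticRel R ts =>
    simp only [Formula.temps] at h
    have := fun i => Term.eval_reframe e (ts i)
      (h.mono (Set.subset_iUnion (fun i => (ts i).temps) i))
    simp only [Formula.Holds, this]
  | relFluent F ts =>
    simp only [Formula.temps] at h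
    have := fun i => Term.eval_reframe e (ts i)
      (h.mono (Set.subset_iUnion (fun i => (ts i).temps) i))
    simp only [Formula.Holds, this, h.rel]
  | not φ ih => exact not_congr (ih e h)
  | and φ ψ ih₁ ih₂ =>
    exact and_congr (ih₁ e (h.mono Set.subset_union_left)) (ih₂ e (h.mono Set.subset_union_right))
  | ex σ φ ih => exact exists_congr fun x => ih _ h

/-- A structure with two situations: `S₀`, and a situation `true` in an arbitrary state. -/
@[reducible]
def Str.probeFrame (M : Str L) : M.Frame :=
  ⟨Bool, false, fun _ s => s, fun _ _ => False, fun _ _ => False⟩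

/-- The states of the two situations of `probeFrame`. -/
def Str.probeState (M : Str L) (σ : M.State) : M.probeFrame.Sit → M.State
  | false => M.stateAt M.S0
  | true => σ

/-- Truth of a uniform formula in a state. -/
def Str.State.Sat {M : Str L} (σ : M.State) {Γ : List Srt} (φ : Formula L Γ)
    (e : Tuple M.Dom Γ) : Prop :=
  φ.Holds (M.reframe M.probeFrame (M.probeState σ)) true e

lemma Str.State.AgreeOn.sat_iff {M : Str L} {σ τ : M.State} {Γ : List Srt} {φ : Formula L Γ}
    (h : Str.State.AgreeOn φ.temps σ τ) (e : Tuple M.Dom Γ) : σ.Sat φ e ↔ τ.Sat φ e :=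
  φ.holds_reframe e h

lemma Formula.holds_reframe_iff_sat {M : Str L} (W : M.Frame) (st : W.Sit → M.State)
    (s : W.Sit) {Γ : List Srt} (φ : Formula L Γ) (e : Tuple M.Dom Γ) :
    φ.Holds (M.reframe W st) s e ↔ (st s).Sat φ e :=
  φ.holds_reframe e (.refl _)

lemma Str.UniqueNames.reframe {M : Str L} (h : M.UniqueNames) (W : M.Frame)
    (st : W.Sit → M.State) : (M.reframe W st).UniqueNames :=
  ⟨h.ne, h.inj⟩

/-! ### Consistency conditions in arbitrary states -/

namespace Theory

variable (D : Theory L)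

/-- The temporal fluents that occur in the initial axioms. -/
def initialTemps : Set L.TempFluent := {f | ∃ φ ∈ D.initial, f ∈ φ.temps}

variable {D} {M : Str L}

lemma ModelsInitial.reframe (h : D.ModelsInitial M) (W : M.Frame) (st : W.Sit → M.State)
    (hS0 : Str.State.AgreeOn D.initialTemps (st W.S0) (M.stateAt M.S0)) :
    D.ModelsInitial (M.reframe W st) where
  initial φ hφ := by
    have := h.initial φ hφ
    refine (φ.holds_reframe (M := M) (W' := M.frame) (st' := M.stateAt) (s' := M.S0) _
      (hS0.mono fun f hf => ?_)).2 this
    exact ⟨φ, hφ, hf⟩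
  time_act := h.time_act

/-- Entailment from the initial theory does not presuppose `Σ`, so a degenerate structure with `σ`
at its second situation is an admissible test. -/
lemma InitialEntails.probe {P : Str L → Prop} (h : D.InitialEntails P) (hU : M.UniqueNames)
    (hI : D.ModelsInitial M) (σ : M.State) :
    P (M.reframe M.probeFrame (M.probeState σ)) :=
  h _ (hU.reframe _ _) (hI.reframe _ _ (.refl _))

lemma IsTemporalBAT.existsUnique_func (hD : D.IsTemporalBAT) (hU : M.UniqueNames)
    (hI : D.ModelsInitial M) (σ : M.State) (f : L.FunFluent) (x : Tuple M.Dom (L.funDom f))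
    (a : M.Act) :
    ∃! y : M.Dom (L.funCod f), σ.Sat (D.ssaFun f)
      (Tuple.cons y (Tuple.cons (σ := .action) a x)) :=
  (hD.func_consistent f).probe hU hI σ x a true

lemma IsTemporalBAT.existsUnique_init (hD : D.IsTemporalBAT) (hU : M.UniqueNames)
    (hI : D.ModelsInitial M) (σ : M.State) (f : L.TempFluent) (x : Tuple M.Dom (L.tempDom f))
    (a : M.Act) :
    ∃! y : M.Dom (L.tempCod f), σ.Sat (D.ssaInit f)
      (Tuple.cons y (Tuple.cons (σ := .action) a x)) :=
  (hD.init_consistent f).probe hU hI σ x a true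

lemma IsTemporalBAT.existsUnique_sea (hD : D.IsTemporalBAT) (hU : M.UniqueNames)
    (hI : D.ModelsInitial M) (σ : M.State) (f : L.TempFluent) (x : Tuple M.Dom (L.tempDom f))
    (t : ℝ) :
    ∃! y : M.Dom (L.tempCod f), σ.Sat (D.sea f)
      (Tuple.cons y (Tuple.cons (σ := .real) t x)) := by
  obtain ⟨⟨y, hy⟩, h⟩ := (hD.sea_consistent f).probe hU hI σ x t true
  exact ⟨y, hy, fun y' hy' => h _ _ hy' hy⟩

/-! ### Solving the state evolution axioms -/

lemma Stratified.wellFounded [Finite L.TempFluent] (h : D.Stratified) :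
    WellFounded fun g f => D.DependsOn f g := by
  have : Std.Irrefl (Relation.TransGen fun g f => D.DependsOn f g) :=
    ⟨fun f hf => h f (Relation.transGen_swap.1 hf)⟩
  have hwf := Finite.wellFounded_of_trans_of_irrefl
    (Relation.TransGen fun g f => D.DependsOn f g)
  exact hwf.mono fun _ _ h => Relation.TransGen.single h

/-- The state evolution axiom of `f` in a state. -/
def EvolvesIn (D : Theory L) (σ : M.State) (f : L.TempFluent) : Prop :=
  ∀ x t y, σ.temp f x t = y ↔ σ.Sat (D.sea f) (Tuple.cons y (Tuple.cons (σ := .real) t x))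

open Classical in
/-- The temporal fluents outside `K` can be reinterpreted so that their state evolution axioms
hold. -/
lemma IsTemporalBAT.exists_evolvesIn [Finite L.TempFluent] (hD : D.IsTemporalBAT)
    (hstrat : D.Stratified) (hU : M.UniqueNames) (hI : D.ModelsInitial M) (K : Set L.TempFluent)
    (σ : M.State) : ∃ τ : M.State, Str.State.AgreeOn K τ σ ∧ ∀ f ∉ K, D.EvolvesIn τ f := by
  -- The values `σ.temp g` outside the dependencies of `f` are placeholders: `ψ_f` does not mention
  -- such `g`.
  let below (f : L.TempFluent) (r : ∀ g, D.DependsOn f g →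
      Tuple M.Dom (L.tempDom g) → ℝ → M.Dom (L.tempCod g)) : M.State :=
    { σ with temp := fun g => if h : D.DependsOn f g then r g h else σ.temp g }
  let step (f : L.TempFluent) (r : ∀ g, D.DependsOn f g →
      Tuple M.Dom (L.tempDom g) → ℝ → M.Dom (L.tempCod g)) :
      Tuple M.Dom (L.tempDom f) → ℝ → M.Dom (L.tempCod f) :=
    if f ∈ K then σ.temp f else
      fun x t => (hD.existsUnique_sea hU hI (below f r) f x t).choose
  let v := hstrat.wellFounded.fix step
  have hv (f) : v f = step f fun g _ => v g := hstrat.wellFounded.fix_eq step f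
  refine ⟨{ σ with temp := v }, ⟨rfl, rfl, rfl, rfl, fun f hf => ?_⟩, fun f hf x t y => ?_⟩
  · exact (hv f).trans (if_pos hf)
  · have hfx : v f x t = (hD.existsUnique_sea hU hI (below f fun g _ => v g) f x t).choose := by
      rw [hv f]; simp only [step, if_neg hf]
    have hspec := (hD.existsUnique_sea hU hI (below f fun g _ => v g) f x t).choose_spec
    -- The value of `f` was chosen in a provisional state; it stays correct because the final state
    -- agrees with that one on every fluent in `ψ_f`.
    have hag : Str.State.AgreeOn (D.sea f).temps { σ with temp := v }
        (below f fun g _ => v g) :=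
      ⟨rfl, rfl, rfl, rfl, fun g hg => by
        have hg : D.DependsOn f g := hg
        simp only [below, dif_pos hg]⟩
    rw [hag.sat_iff]
    show v f x t = y ↔ _
    rw [hfx]
    exact ⟨fun h => h ▸ hspec.1, fun h => (hspec.2 y h).symm⟩

/-- `τ` is a state that can result from doing `a` in the state `σ`. -/
structure IsSuccessor (D : Theory L) (σ : M.State) (a : M.Act) (τ : M.State) : Prop where
  start : τ.start = M.time a
  rel : ∀ F x, τ.rel F x ↔ σ.Sat (D.ssaRel F) (Tuple.cons (σ := .action) a x)
  func : ∀ f x y, τ.func f x = y ↔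
    σ.Sat (D.ssaFun f) (Tuple.cons y (Tuple.cons (σ := .action) a x))
  init : ∀ f x y, τ.init f x = y ↔
    σ.Sat (D.ssaInit f) (Tuple.cons y (Tuple.cons (σ := .action) a x))
  evolves : ∀ f, D.EvolvesIn τ f

lemma IsTemporalBAT.exists_isSuccessor [Finite L.TempFluent] (hD : D.IsTemporalBAT)
    (hstrat : D.Stratified) (hU : M.UniqueNames) (hI : D.ModelsInitial M)
    (σ : M.State) (a : M.Act) : ∃ τ : M.State, D.IsSuccessor σ a τ := by
  choose F hF hF' using fun f x => hD.existsUnique_func hU hI σ f x a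
  choose G hG hG' using fun f x => hD.existsUnique_init hU hI σ f x a
  -- With `K = ∅` every temporal fluent is recomputed, so the old values `σ.temp` are only
  -- placeholders.
  obtain ⟨τ, h, hτ⟩ := hD.exists_evolvesIn hstrat hU hI ∅
    { start := M.time a
      rel := fun F x => σ.Sat (D.ssaRel F) (Tuple.cons (σ := .action) a x)
      func := F
      init := G
      temp := σ.temp }
  refine ⟨τ, h.start, fun f x => by rw [h.rel], fun f x y => ?_, fun f x y => ?_,
    fun f => hτ f (Set.notMem_empty f)⟩
  · rw [h.func]
    exact ⟨fun e => e ▸ hF f x, fun e => (hF' f x y e).symm⟩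
  · rw [h.init]
    exact ⟨fun e => e ▸ hG f x, fun e => (hG' f x y e).symm⟩

/-! ### The model on the tree of situations -/

/-- The tree of situations, given as lists of actions, with a state attached to each of them. -/
@[reducible]
def treeFrame (D : Theory L) (M : Str L) (st : List M.Act → M.State) : M.Frame where
  Sit := List M.Act
  S0 := []
  doAct := List.cons
  Poss a s := ∃ A x t, a = M.actFun A x t ∧ (st s).Sat (D.precond A) (Tuple.cons t x)
  prec s s' := ∃ l, l ≠ [] ∧ l ++ s = s'

lemma foundational_treeFrame (st : List M.Act → M.State)
    (hst : ∀ a s, (st (a :: s)).start = M.time a) :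
    (M.reframe (D.treeFrame M st) st).Foundational where
  do_inj a₁ a₂ s₁ s₂ h := List.cons.inj h
  induction P h0 hs s := by
    induction s with
    | nil => exact h0
    | cons a s ih => exact hs a s ih
  not_prec_S0 := by
    rintro s ⟨l, hl, h⟩
    exact hl (List.append_eq_nil_iff.1 h).1
  prec_do a s s' := by
    constructor
    · rintro ⟨_ | ⟨b, l⟩, hl, h⟩
      · exact absurd rfl hl
      · have h' := (List.cons.inj h).2
        rcases l with _ | ⟨c, l⟩
        · exact .inr h'
        · exact .inl ⟨_, List.cons_ne_nil _ _, h'⟩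
    · rintro (⟨l, -, h⟩ | h)
      · exact ⟨a :: l, List.cons_ne_nil _ _, congrArg (List.cons a) h⟩
      · exact ⟨[a], List.cons_ne_nil _ _, congrArg (List.cons a) h⟩
  start_do := hst

/-- Unique names make the decomposition of an action as `A(x̄, t)` unique, so the existential
defining `Poss` reduces to the single instance `Π_A`. -/
lemma modelsPrecond_treeFrame (hU : M.UniqueNames) (st : List M.Act → M.State) :
    D.ModelsPrecond (M.reframe (D.treeFrame M st) st) := by
  intro A x t s
  rw [Formula.holds_reframe_iff_sat]
  constructor
  · rintro ⟨B, x', t', h, hB⟩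
    obtain rfl : A = B := by
      by_contra hne
      exact hU.ne A B hne _ _ _ _ h
    obtain ⟨rfl, rfl⟩ := hU.inj _ _ _ _ _ h
    exact hB
  · exact fun h => ⟨A, x, t, rfl, h⟩

theorem IsTemporalBAT.satisfiable_of_initialSatisfiable [Finite L.TempFluent]
    (hD : D.IsTemporalBAT) (hstrat : D.Stratified) (hinit : D.InitiallyCompatible)
    (h : D.InitialSatisfiable) : D.Satisfiable := by
  obtain ⟨M, hU, hI⟩ := h
  obtain ⟨σ₀, hσ₀, hev₀⟩ := hD.exists_evolvesIn hstrat hU hI D.initialTemps (M.stateAt M.S0)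
  choose next hnext using hD.exists_isSuccessor hstrat hU hI
  let st : List M.Act → M.State := fun s => s.foldr (fun a σ => next σ a) σ₀
  have hst (a s) : D.IsSuccessor (st s) a (st (a :: s)) := hnext _ _
  have hI' : D.ModelsInitial (M.reframe (D.treeFrame M st) st) := hI.reframe _ _ hσ₀
  have hU' : (M.reframe (D.treeFrame M st) st).UniqueNames := hU.reframe _ _
  have hev {f s} (hf : D.EvolvesIn (st s) f) :
      D.EvolvesAt (M.reframe (D.treeFrame M st) st) f s := fun x t y => by
    rw [Formula.holds_reframe_iff_sat]
    exact hf x t y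
  refine ⟨M.reframe (D.treeFrame M st) st,
    foundational_treeFrame st fun a s => (hst a s).start, ⟨?_, ?_, ?_⟩,
    modelsPrecond_treeFrame hU st, hU', hI', ?_⟩
  · intro F x a s
    rw [Formula.holds_reframe_iff_sat]
    exact (hst a s).rel F x
  · intro f x a s y
    rw [Formula.holds_reframe_iff_sat]
    exact (hst a s).func f x y
  · intro f x a s y
    rw [Formula.holds_reframe_iff_sat]
    exact (hst a s).init f x y
  · rintro f (_ | ⟨a, s⟩)
    · by_cases hf : f ∈ D.initialTemps
      · obtain ⟨φ, hφ, hfφ⟩ := hf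
        -- Compatibility is applied to the new structure, not to `M`: the preserved values already
        -- make it a model of the initial theory.
        exact hinit φ hφ f hfφ _ hU' hI'
      · exact hev (hev₀ f hf)
    · exact hev ((hst a s).evolves f)

end Theory

end HybridSC

theorem theorem2 (L : HybridSC.Signature) [Finite L.TempFluent] (D : HybridSC.Theory L)
    (hD : D.IsTemporalBAT) (hstrat : D.Stratified) (hinit : D.InitiallyCompatible) :
    D.Satisfiable ↔ D.InitialSatisfiable :=
  ⟨fun ⟨M, hM⟩ => ⟨M, hM.uniqueNames, hM.initial⟩,
    hD.satisfiable_of_initialSatisfiable hstrat hinit⟩
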